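/- Let $\mathbb{S}^3$ be the 6-dimensional space of complex symmetric $3\times 3$ matrices, identified with quadratic forms in $x,y,z$, on which $P\in \mathrm{GL}_3(\mathbb{C})$ acts by congruence $M\mapsto P^TMP$. A net of conics (a 3-dimensional linear subspace $\mathcal{L}\subset\mathbb{S}^3$) is of type $B$, respectively $C$, if it is congruent to the net spanned by $$S_1=y^2+2xz,\qquad S_2=2yz,\qquad S_3=\begin{cases}-x^2-2y^2-9z^2+2xz & (\text{type } B),\\ -x^2 & (\text{type } C).\end{cases}$$ Put $g=1$ for type $B$ and $g=0$ for type $C$. Let $v:\mathbb{P}^2\to\mathbb{P}^5=\mathbb{P}\mathbb{S}^3$, $a\mapsto aa^T$, be the Veronese embedding. The reciprocal surface $\mathbb{P}\mathcal{L}^{-1}\subset\mathbb{P}^5$ is the Zariski closure of $\{[A^{-1}] : A\in\mathcal{L},\ \det A\neq 0\}$. A projection of a subset $X\subset\mathbb{P}^5$ from a point $p$ is the Zariski closure of the image of $X\setminus\{p\}$ under the map $\mathbb{P}^5\setminus\{p\}\to\mathbb{P}^5$ induced by a linear map $\pi:\mathbb{S}^3\to\mathbb{S}^3$ whose kernel is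 the line $p$. **Proposition 3.5.** Let $\mathcal{L}$ be a net of type $B$ or $C$. Then $\mathbb{P}\mathcal{L}^{-1}$ has dimension $2$ and degree $3$, and it is a projection of the Veronese surface $v(\mathbb{P}^2)$ from a point on the Veronese surface. More precisely, for every $P\in \mathrm{GL}_3(\mathbb{C})$ such that $\mathcal{L}$ is spanned by the matrices $P^TS_iP$ $(i=1,2,3)$, there is a linear map $\pi:\mathbb{S}^3\to\mathbb{S}^3$ with $$\pi\bigl(aa^T\bigr)=\operatorname{adj}\bigl(\alpha\,P^TS_1P+\beta\,P^TS_2P+\gamma\,P^TS_3P\bigr)\qquad\text{for all } a=(\alpha,\beta,\gamma)^T\in\mathbb{C}^3,$$ the kernel of $\pi$ is the line $v(2g:0:1)$, and $\mathbb{P}\mathcal{L}^{-1}$ is the projection of the Veronese surface from the point $v(2g:0:1)$ induced by $\pi$. -/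

import Mathlib

namespace NetsOfConics

noncomputable section

open Matrix Polynomial
open scoped LinearAlgebra.Projectivization

/-- The 6-dimensional space of complex symmetric `3 × 3` matrices. -/
def SymMat : Submodule ℂ (Matrix (Fin 3) (Fin 3) ℂ) where
  carrier := {M | M.IsSymm}
  add_mem' hM hN := hM.add hN
  zero_mem' := Matrix.isSymm_zero
  smul_mem' c _ hM := hM.smul c

/-- The projective space `ℙ⁵` of symmetric `3 × 3` matrices. -/
abbrev P5 : Type := ℙ ℂ SymMat

/-! ### Projective geometry in `ℙ⁵` -/

/-- The six homogeneous coordinates `(u₁₁, u₂₂, u₃₃, u₁₂, u₁₃, u₂₃)` of a symmetric matrix. -/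
def coords (M : SymMat) : Fin 6 → ℂ :=
  ![M.1 0 0, M.1 1 1, M.1 2 2, M.1 0 1, M.1 0 2, M.1 1 2]

/-- The (homogeneous) vanishing ideal of a subset of `ℙ⁵`: the polynomials that vanish at all
representatives of all of its points. -/
def vanishingIdeal (Z : Set P5) : Ideal (MvPolynomial (Fin 6) ℂ) where
  carrier := {f | ∀ x ∈ Z, ∀ M ∈ x.submodule, MvPolynomial.eval (coords M) f = 0}
  add_mem' hf hg x hx M hM := by rw [map_add, hf x hx M hM, hg x hx M hM, add_zero]
  zero_mem' _ _ _ _ := map_zero _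
  smul_mem' f g hg x hx M hM := by rw [smul_eq_mul, map_mul, hg x hx M hM, mul_zero]

/-- The Zariski closure of a subset of `ℙ⁵`: the common zeros of its vanishing ideal. -/
def zariskiClosure (Z : Set P5) : Set P5 :=
  {x | ∀ f ∈ vanishingIdeal Z, ∀ M ∈ x.submodule, MvPolynomial.eval (coords M) f = 0}

/-- The Hilbert function of the homogeneous coordinate ring of a subset of `ℙ⁵`: in degree `n`, the
dimension of the forms of degree `n` modulo those in the vanishing ideal. -/
def hilbertFunction (Z : Set P5) (n : ℕ) : ℕ :=
  Module.finrank ℂ (MvPolynomial.homogeneousSubmodule (Fin 6) ℂ n ⧸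
    ((vanishingIdeal Z).restrictScalars ℂ).comap
      (MvPolynomial.homogeneousSubmodule (Fin 6) ℂ n).subtype)

/-- `q` is the Hilbert polynomial of `Z`. -/
def IsHilbertPolynomial (Z : Set P5) (q : ℚ[X]) : Prop :=
  ∀ᶠ n : ℕ in Filter.atTop, (hilbertFunction Z n : ℚ) = q.eval (n : ℚ)

/-- `Z` has dimension `r` and degree `d`: its Hilbert polynomial has degree `r` and leading
coefficient `d / r!`. -/
def HasDimAndDegree (Z : Set P5) (r d : ℕ) : Prop :=
  ∃ q : ℚ[X], IsHilbertPolynomial Z q ∧ q.degree = (r : WithBot ℕ) ∧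
    q.leadingCoeff * (r.factorial : ℚ) = (d : ℚ)

/-- The image of `X ⊆ ℙ⁵` under the rational map of projective spaces induced by a linear map:
the Zariski closure of the image of the points of `X` outside the projectivized kernel. -/
def imageUnder (π : SymMat →ₗ[ℂ] SymMat) (X : Set P5) : Set P5 :=
  zariskiClosure {y | ∃ x ∈ X, ∃ M ∈ x.submodule, ∃ h : π M ≠ 0, y = Projectivization.mk ℂ (π M) h}

/-- The linear map `π` exhibits `Y` as the projection of `X` from the point `p`. -/
def IsProjectionVia (π : SymMat →ₗ[ℂ] SymMat) (X : Set P5) (p : P5) (Y : Set P5) : Prop :=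
  LinearMap.ker π = p.submodule ∧ Y = imageUnder π X

/-! ### The Veronese surface -/

/-- The symmetric matrix `(aᵢ aⱼ)` of a vector `a`. -/
def veroneseVec (a : Fin 3 → ℂ) : SymMat :=
  ⟨vecMulVec a a, by
    change (vecMulVec a a)ᵀ = vecMulVec a a
    rw [transpose_vecMulVec]⟩

lemma veroneseVec_ne_zero {a : Fin 3 → ℂ} (ha : a ≠ 0) : veroneseVec a ≠ 0 := by
  obtain ⟨i, hi⟩ := Function.ne_iff.mp ha
  intro h
  have h1 : (veroneseVec a).1 i i = 0 := by rw [h]; rfl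
  exact mul_ne_zero hi hi h1

/-- The Veronese embedding `v : ℙ² → ℙ⁵`, `(α : β : γ) ↦ [(α, β, γ)ᵀ (α, β, γ)]`. -/
def veronese : ℙ ℂ (Fin 3 → ℂ) → P5 :=
  Projectivization.lift
    (fun a => Projectivization.mk ℂ (veroneseVec a.1) (veroneseVec_ne_zero a.2)) (by
      rintro ⟨a, ha⟩ ⟨b, hb⟩ t h
      simp only at h
      rw [Projectivization.mk_eq_mk_iff']
      refine ⟨t * t, ?_⟩
      apply Subtype.ext
      ext i j
      simp only [veroneseVec, h, SetLike.val_smul, Matrix.smul_apply, vecMulVec_apply,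
        Pi.smul_apply, smul_eq_mul]
      ring)

/-- The Veronese surface in `ℙ⁵`. -/
def veroneseSurface : Set P5 := Set.range veronese

/-! ### Nets of conics and their reciprocal surfaces -/

/-- The inverse of a symmetric matrix. -/
def symInv (A : SymMat) : SymMat :=
  ⟨A.1⁻¹, by
    change (A.1⁻¹)ᵀ = A.1⁻¹
    rw [transpose_nonsing_inv, show A.1ᵀ = A.1 from A.2]⟩

/-- The reciprocal surface of a net: the Zariski closure of the set of the classes of the inverses
of its invertible matrices. -/
def reciprocalSurface (L : Submodule ℂ SymMat) : Set P5 :=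
  zariskiClosure {x | ∃ A ∈ L, A.1.det ≠ 0 ∧
    ∃ h : symInv A ≠ 0, x = Projectivization.mk ℂ (symInv A) h}

/-- The congruence action `M ↦ Pᵀ M P`. -/
def congruence (P : GL (Fin 3) ℂ) : SymMat →ₗ[ℂ] SymMat where
  toFun M := ⟨(P.1)ᵀ * M.1 * P.1, by
    change ((P.1)ᵀ * M.1 * P.1)ᵀ = (P.1)ᵀ * M.1 * P.1
    rw [transpose_mul, transpose_mul, transpose_transpose, show M.1ᵀ = M.1 from M.2,
      Matrix.mul_assoc]⟩
  map_add' M N := by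
    apply Subtype.ext
    simp [Matrix.mul_add, Matrix.add_mul]
  map_smul' c M := by
    apply Subtype.ext
    simp

/-- The two types of nets considered here. -/
inductive NetType
  | B
  | C

/-- The constant `g` of the type: `1` for `B` and `0` for `C`. -/
def NetType.g : NetType → ℂ
  | .B => 1
  | .C => 0

/-- The matrices of the generators `y² + 2xz`, `2yz` and
`-x² - 2y² - 9z² + 2xz` (type `B`), respectively `-x²` (type `C`). -/
def NetType.genMatrix : NetType → Fin 3 → Matrix (Fin 3) (Fin 3) ℂ
  | .B => ![!![0, 0, 1; 0, 1, 0; 1, 0, 0],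
            !![0, 0, 0; 0, 0, 1; 0, 1, 0],
            !![-1, 0, 1; 0, -2, 0; 1, 0, -9]]
  | .C => ![!![0, 0, 1; 0, 1, 0; 1, 0, 0],
            !![0, 0, 0; 0, 0, 1; 0, 1, 0],
            !![-1, 0, 0; 0, 0, 0; 0, 0, 0]]

lemma NetType.genMatrix_mem (τ : NetType) (i : Fin 3) : τ.genMatrix i ∈ SymMat := by
  change (τ.genMatrix i)ᵀ = τ.genMatrix i
  cases τ <;> fin_cases i <;> ext j k <;> fin_cases j <;> fin_cases k <;> rfl

/-- The three generators of the standard net of the given type. -/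
def NetType.gen (τ : NetType) (i : Fin 3) : SymMat := ⟨τ.genMatrix i, τ.genMatrix_mem i⟩

/-- The standard net of the given type. -/
def NetType.standardNet (τ : NetType) : Submodule ℂ SymMat :=
  Submodule.span ℂ (Set.range τ.gen)

/-- `L` is a net of type `τ`: it lies in the orbit of the standard net under congruence. -/
def IsOfType (τ : NetType) (L : Submodule ℂ SymMat) : Prop :=
  ∃ P : GL (Fin 3) ℂ, L = τ.standardNet.map (congruence P)

/-- The point `(2g : 0 : 1)` of `ℙ²`. -/
def NetType.basePoint (τ : NetType) : ℙ ℂ (Fin 3 → ℂ) :=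
  Projectivization.mk ℂ ![2 * τ.g, 0, 1] (fun h => one_ne_zero (congrFun h 2))

end

end NetsOfConics

namespace NetsOfConics

noncomputable section

open Matrix MvPolynomial
open scoped LinearAlgebra.Projectivization Pointwise

/-! The adjugate of the general matrix `α A₁ + β A₂ + γ A₃` of a net is quadratic in `(α, β, γ)`,
so it is `π (a aᵀ)` for a linear map `π`, and the reciprocal surface is the image of the Veronese
surface under `π`. For the types `B` and `C` the kernel of `π` is the line of `v(2g : 0 : 1)`;
congruences only change `π` by an automorphism of `ℙ⁵`.

Pulled back along the Veronese embedding, the linear forms vanishing on the kernel are the conics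
through the center `p`, and the Hilbert function of the projection at `n` is the dimension of the
`n`-th power of this space of conics. After moving `p` to `(0 : 0 : 1)` this power is spanned by the
monomials of degree `2n` and degree at most `n` in the last variable. Their number is
`(n + 1) (3n + 2) / 2`, with leading term `3 n² / 2`. -/

section General

variable {σ ι n R S K V W : Type*}

lemma map_aeval_homogeneousSubmodule [CommSemiring R] [CommSemiring S] [Algebra R S]
    (p : σ → S) (n : ℕ) :
    (homogeneousSubmodule σ R n).map (aeval p).toLinearMap =
      Submodule.span R (Set.range p) ^ n := by
  rw [← homogeneousSubmodule_one_pow, Submodule.map_pow, homogeneousSubmodule_one_eq_span_X,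
    Submodule.map_span, ← Set.range_comp]
  congr 3
  exact funext fun i => aeval_X p i

lemma exists_eval_eq_det [Fintype ι] [Fintype n] [DecidableEq n] [CommRing R]
    (A : ι → Matrix n n R) :
    ∃ D : MvPolynomial ι R, ∀ a, eval a D = (∑ i, a i • A i).det := by
  refine ⟨(∑ i, (X i : MvPolynomial ι R) • (A i).map C).det, fun a => ?_⟩
  rw [RingHom.map_det]
  congr 1
  ext j k
  simp [Matrix.sum_apply]

lemma eq_zero_of_eval_eq_zero_of_eval_ne_zero [CommRing R] [IsDomain R] [Infinite R]
    {D f : MvPolynomial σ R} (hD : D ≠ 0) (hf : ∀ a, eval a D ≠ 0 → eval a f = 0) : f = 0 := by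
  refine (mul_eq_zero.mp (MvPolynomial.funext fun a => ?_ : D * f = 0)).resolve_left hD
  rw [map_mul, map_zero, mul_eq_zero]
  exact or_iff_not_imp_left.mpr (hf a)

lemma finrank_restrictSupport [CommRing R] [Nontrivial R] (s : Set (σ →₀ ℕ)) :
    Module.finrank R (restrictSupport R s) = Nat.card s :=
  Module.finrank_eq_nat_card_basis (basisRestrictSupport R s)

variable [Field K] [AddCommGroup V] [Module K V] [AddCommGroup W] [Module K W]

lemma span_range_coord_comp [Finite ι] (b : Module.Basis ι K V) (f : W →ₗ[K] V) :
    Submodule.span K (Set.range fun i => b.coord i ∘ₗ f) =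
      (LinearMap.ker f).dualAnnihilator := by
  classical
  rw [← LinearMap.range_dualMap_eq_dualAnnihilator_ker, LinearMap.range_eq_map,
    ← b.dualBasis.span_eq, Submodule.map_span, ← Set.range_comp, b.coe_dualBasis]
  rfl

lemma dualAnnihilator_span_basis_singleton [Finite ι] (b : Module.Basis ι K V) (k : ι) :
    (Submodule.span K {b k}).dualAnnihilator = Submodule.span K (b.coord '' {k}ᶜ) := by
  classical
  ext ℓ
  rw [← b.coe_dualBasis, b.dualBasis.mem_span_image, Submodule.mem_dualAnnihilator]
  simpa [Submodule.mem_span_singleton, Set.subset_compl_singleton_iff] using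
    ⟨fun h => (h 1).resolve_left one_ne_zero, fun h _ => .inr h⟩

lemma exists_mk_vecMul_eq [Fintype n] [DecidableEq n] {a : n → K} (ha : a ≠ 0)
    (x : ℙ K (n → K)) :
    ∃ (P : GL n K) (h : a ᵥ* P.1 ≠ 0), .mk K (a ᵥ* P.1) h = x := by
  obtain ⟨g, rfl⟩ := MulAction.exists_smul_eq (SpecialLinearGroup n K) (.mk K a ha) x
  have h : g • a = a ᵥ* (g : Matrix n n K)ᵀ := (vecMul_transpose (g : Matrix n n K) a).symm
  exact ⟨(g.transpose : SpecialLinearGroup n K), h ▸ (smul_ne_zero_iff_ne g).mpr ha,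
    (Projectivization.mk_eq_mk_iff' K _ _ _ _).mpr ⟨1, (one_smul K _).trans h⟩⟩

end General

section ProjectiveSpace

lemma vanishingIdeal_anti {Z W : Set P5} (h : Z ⊆ W) : vanishingIdeal W ≤ vanishingIdeal Z :=
  fun _ hf x hx => hf x (h hx)

lemma subset_zariskiClosure (Z : Set P5) : Z ⊆ zariskiClosure Z :=
  fun x hx _ hf => hf x hx

lemma vanishingIdeal_zariskiClosure (Z : Set P5) :
    vanishingIdeal (zariskiClosure Z) = vanishingIdeal Z :=
  le_antisymm (vanishingIdeal_anti (subset_zariskiClosure Z)) fun f hf _ hx => hx f hf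

lemma zariskiClosure_congr {Z W : Set P5} (h : vanishingIdeal Z = vanishingIdeal W) :
    zariskiClosure Z = zariskiClosure W := by
  simp only [zariskiClosure, h]

lemma hilbertFunction_eq_finrank_span_pow {S : Type*} [CommRing S] [Algebra ℂ S] {Z : Set P5}
    {p : Fin 6 → S} (h : ∀ f, f ∈ vanishingIdeal Z ↔ aeval p f = 0) (n : ℕ) :
    hilbertFunction Z n =
      Module.finrank ℂ (Submodule.span ℂ (Set.range p) ^ n : Submodule ℂ S) := by
  have hker : ((vanishingIdeal Z).restrictScalars ℂ).comap
      (homogeneousSubmodule (Fin 6) ℂ n).subtype =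
      LinearMap.ker ((aeval p).toLinearMap.domRestrict (homogeneousSubmodule (Fin 6) ℂ n)) := by
    ext f
    simp [h]
  rw [hilbertFunction, hker, (LinearMap.quotKerEquivRange _).finrank_eq,
    LinearMap.range_domRestrict, map_aeval_homogeneousSubmodule]

end ProjectiveSpace

section ConicExponents

/-- The exponents of the monomials of degree `2 * n` in three variables that vanish to order at
least `n` at the point `(0 : 0 : 1)`. For `n = 1` these are the conics through that point. -/
def conicExponents (n : ℕ) : Set (Fin 3 →₀ ℕ) :=
  {e | e 0 + e 1 + e 2 = 2 * n ∧ e 2 ≤ n}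

lemma conicExponents_succ (n : ℕ) :
    conicExponents (n + 1) = conicExponents n + conicExponents 1 := by
  ext e
  refine ⟨fun ⟨hdeg, hle⟩ => ?_, ?_⟩
  · let s₂ := min (e 2) 1
    let s₀ := min (e 0) (2 - s₂)
    refine ⟨Finsupp.equivFunOnFinite.symm ![e 0 - s₀, e 1 - (2 - s₂ - s₀), e 2 - s₂], ⟨?_, ?_⟩,
      Finsupp.equivFunOnFinite.symm ![s₀, 2 - s₂ - s₀, s₂], ⟨?_, ?_⟩,
      by ext i; fin_cases i <;> simp <;> omega⟩
    all_goals
      simp only [Finsupp.equivFunOnFinite_symm_apply_apply, Matrix.cons_val]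
      omega
  · rintro ⟨d, ⟨hd, hd'⟩, s, ⟨hs, hs'⟩, rfl⟩
    simp only [conicExponents, Set.mem_ofPred_eq, Finsupp.add_apply]
    omega

lemma nsmul_conicExponents_one (n : ℕ) : n • conicExponents 1 = conicExponents n := by
  induction n with
  | zero =>
    ext e
    rw [zero_nsmul, Set.mem_zero, Finsupp.ext_iff, Fin.forall_fin_succ]
    simp only [conicExponents, Set.mem_ofPred_eq, Finsupp.coe_zero, Pi.zero_apply,
      Fin.forall_fin_succ, Fin.succ_zero_eq_one, Fin.succ_one_eq_two, IsEmpty.forall_iff,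
      and_true]
    omega
  | succ n ih => rw [succ_nsmul, ih, conicExponents_succ n]

lemma card_conicExponents_eq_sum (n : ℕ) :
    Nat.card (conicExponents n) = ∑ k ∈ Finset.range (n + 1), (2 * n - k + 1) := by
  let byLastExponent : conicExponents n ≃ Σ k : Fin (n + 1), Fin (2 * n - k + 1) :=
    { toFun := fun e => ⟨⟨e.1 2, Nat.lt_succ_of_le e.2.2⟩, ⟨e.1 0, by
        have := e.2.1
        dsimp only
        omega⟩⟩
      invFun := fun p => ⟨Finsupp.equivFunOnFinite.symm ![p.2, 2 * n - p.1 - p.2, p.1], by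
        have := p.1.2
        have := p.2.2
        simp only [conicExponents, Set.mem_ofPred_eq, Finsupp.equivFunOnFinite_symm_apply_apply,
          Matrix.cons_val]
        omega⟩
      left_inv := fun e => by
        have := e.2.1
        ext i
        fin_cases i
        · rfl
        · change 2 * n - e.1 2 - e.1 0 = e.1 1
          omega
        · rfl
      right_inv := fun ⟨⟨k, hk⟩, ⟨i, hi⟩⟩ => by simp }
  rw [Nat.card_congr byLastExponent, Nat.card_eq_fintype_card, Fintype.card_sigma]
  simp only [Fintype.card_fin, Fin.sum_univ_eq_sum_range (fun k => 2 * n - k + 1)]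

lemma card_conicExponents (n : ℕ) :
    2 * Nat.card (conicExponents n) = (n + 1) * (3 * n + 2) := by
  have hreflect : ∑ k ∈ Finset.range (n + 1), (2 * n - k + 1) =
      ∑ j ∈ Finset.range (n + 1), (n + j + 1) := by
    rw [← Finset.sum_range_reflect]
    refine Finset.sum_congr rfl fun j hj => ?_
    have := Finset.mem_range.mp hj
    omega
  have gauss : (∑ j ∈ Finset.range (n + 1), j) * 2 = (n + 1) * n :=
    Finset.sum_range_id_mul_two (n + 1)
  rw [card_conicExponents_eq_sum, hreflect, Finset.sum_add_distrib, Finset.sum_add_distrib]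
  simp only [Finset.sum_const, Finset.card_range, smul_eq_mul]
  linarith

end ConicExponents

section Coordinates

/-- The homogeneous coordinates `coords` on `ℙ⁵` as a linear isomorphism. -/
def coordsEquiv : SymMat ≃ₗ[ℂ] (Fin 6 → ℂ) where
  toFun := coords
  map_add' M N := by
    ext i
    fin_cases i <;> rfl
  map_smul' c M := by
    ext i
    fin_cases i <;> rfl
  invFun u := ⟨!![u 0, u 3, u 4; u 3, u 1, u 5; u 4, u 5, u 2], Matrix.IsSymm.ext fun i j => by
    fin_cases i <;> fin_cases j <;> rfl⟩
  left_inv M := by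
    ext i j
    fin_cases i <;> fin_cases j <;> first | rfl | exact M.2.apply _ _
  right_inv u := by
    ext i
    fin_cases i <;> rfl

/-- The basis of the space of symmetric matrices in which `coords` are the coordinates. -/
def coordsBasis : Module.Basis (Fin 6) ℂ SymMat := .ofEquivFun coordsEquiv

lemma coordsBasis_coord_apply (i : Fin 6) (M : SymMat) : coordsBasis.coord i M = coords M i :=
  rfl

/-- The exponent of the quadratic monomial that is the `j`-th coordinate of the Veronese
embedding. -/
def veroneseExponent : Fin 6 → Fin 3 →₀ ℕ :=
  ![.single 0 2, .single 1 2, .single 2 2, .single 0 1 + .single 1 1,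
    .single 0 1 + .single 2 1, .single 1 1 + .single 2 1]

/-- The pullback of linear forms on `ℙ⁵` along the Veronese embedding, which yields the quadratic
forms on `ℙ²`. -/
def veronesePullback : Module.Dual ℂ SymMat →ₗ[ℂ] MvPolynomial (Fin 3) ℂ :=
  coordsBasis.dualBasis.constr ℂ fun j => monomial (veroneseExponent j) 1

lemma veronesePullback_coord (j : Fin 6) :
    veronesePullback (coordsBasis.coord j) = monomial (veroneseExponent j) 1 := by
  rw [veronesePullback, ← coordsBasis.coe_dualBasis, Module.Basis.constr_basis]

lemma eval_veronesePullback (a : Fin 3 → ℂ) (ℓ : Module.Dual ℂ SymMat) :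
    eval a (veronesePullback ℓ) = ℓ (veroneseVec a) := by
  suffices h : (aeval a).toLinearMap ∘ₗ veronesePullback =
      Module.Dual.eval ℂ SymMat (veroneseVec a) from LinearMap.congr_fun h ℓ
  refine coordsBasis.dualBasis.ext fun j => ?_
  rw [coordsBasis.coe_dualBasis, LinearMap.comp_apply, veronesePullback_coord,
    Module.Dual.eval_apply, coordsBasis_coord_apply]
  fin_cases j <;>
    simp [veroneseExponent, coords, veroneseVec, vecMulVec_apply, aeval_monomial,
      Finsupp.prod_add_index', pow_add, sq]

lemma image_veroneseExponent_compl_singleton :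
    veroneseExponent '' {2}ᶜ = conicExponents 1 := by
  ext e
  constructor
  · rintro ⟨j, hj, rfl⟩
    fin_cases j <;> simp [veroneseExponent, conicExponents] at hj ⊢
  · rintro ⟨hdeg, hle⟩
    have hcases : e 0 = 2 ∧ e 1 = 0 ∧ e 2 = 0 ∨ e 0 = 0 ∧ e 1 = 2 ∧ e 2 = 0 ∨
        e 0 = 1 ∧ e 1 = 1 ∧ e 2 = 0 ∨ e 0 = 1 ∧ e 1 = 0 ∧ e 2 = 1 ∨
        e 0 = 0 ∧ e 1 = 1 ∧ e 2 = 1 := by omega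
    obtain ⟨j, hj, he⟩ : ∃ j ≠ 2, ∀ i, veroneseExponent j i = e i := by
      rcases hcases with h | h | h | h | h
      · exact ⟨0, by decide, by simp [Fin.forall_fin_succ, veroneseExponent, h]⟩
      · exact ⟨1, by decide, by simp [Fin.forall_fin_succ, veroneseExponent, h]⟩
      · exact ⟨3, by decide, by simp [Fin.forall_fin_succ, veroneseExponent, h]⟩
      · exact ⟨4, by decide, by simp [Fin.forall_fin_succ, veroneseExponent, h]⟩
      · exact ⟨5, by decide, by simp [Fin.forall_fin_succ, veroneseExponent, h]⟩
    exact ⟨j, hj, Finsupp.ext he⟩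

lemma map_veronesePullback_dualAnnihilator :
    (Submodule.span ℂ {coordsBasis 2}).dualAnnihilator.map veronesePullback =
      restrictSupport ℂ (conicExponents 1) := by
  rw [dualAnnihilator_span_basis_singleton, Submodule.map_span, Set.image_image,
    restrictSupport_eq_span, ← image_veroneseExponent_compl_singleton, Set.image_image]
  simp only [veronesePullback_coord]

end Coordinates

section ProjectedVeronese

lemma smul_veroneseVec (c : ℂ) (a : Fin 3 → ℂ) : veroneseVec (c • a) = c ^ 2 • veroneseVec a := by
  ext i j
  simp only [veroneseVec, SetLike.val_smul, Matrix.smul_apply, vecMulVec_apply, Pi.smul_apply,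
    smul_eq_mul]
  ring

lemma exists_veroneseVec_eq_smul (c : ℂ) (a : Fin 3 → ℂ) :
    ∃ b, veroneseVec b = c • veroneseVec a := by
  obtain ⟨d, rfl⟩ := IsAlgClosed.exists_pow_nat_eq c two_pos
  exact ⟨d • a, smul_veroneseVec d a⟩

lemma submodule_veronese_mk {a : Fin 3 → ℂ} (ha : a ≠ 0) :
    (veronese (.mk ℂ a ha)).submodule = Submodule.span ℂ {veroneseVec a} :=
  Projectivization.submodule_mk _ _

/-- The image of the Veronese surface under the rational map induced by `π`, before taking the
Zariski closure. -/
def projectedVeronese (π : SymMat →ₗ[ℂ] SymMat) : Set P5 :=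
  {y | ∃ a, ∃ h : π (veroneseVec a) ≠ 0, y = .mk ℂ (π (veroneseVec a)) h}

lemma imageUnder_veroneseSurface (π : SymMat →ₗ[ℂ] SymMat) :
    imageUnder π veroneseSurface = zariskiClosure (projectedVeronese π) := by
  refine congrArg zariskiClosure (Set.ext fun y => ⟨?_, ?_⟩)
  · rintro ⟨_, ⟨x, rfl⟩, M, hM, h, rfl⟩
    induction x with | h a ha =>
    obtain ⟨c, rfl⟩ := Submodule.mem_span_singleton.mp (submodule_veronese_mk ha ▸ hM)
    obtain ⟨b, hb⟩ := exists_veroneseVec_eq_smul c a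
    exact ⟨b, hb ▸ h, by simp only [hb]⟩
  · rintro ⟨a, h, rfl⟩
    have ha : a ≠ 0 := by
      rintro rfl
      exact h (by simpa using congrArg π (smul_veroneseVec 0 0))
    refine ⟨_, ⟨.mk ℂ a ha, rfl⟩, veroneseVec a, ?_, h, rfl⟩
    rw [submodule_veronese_mk]
    exact Submodule.mem_span_singleton_self _

/-- The quadratic forms that are the coordinates of `a ↦ π (a aᵀ)`. -/
def imageCoords (π : SymMat →ₗ[ℂ] SymMat) (i : Fin 6) : MvPolynomial (Fin 3) ℂ :=
  veronesePullback (coordsBasis.coord i ∘ₗ π)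

lemma eval_aeval_imageCoords (π : SymMat →ₗ[ℂ] SymMat) (f : MvPolynomial (Fin 6) ℂ)
    (a : Fin 3 → ℂ) :
    eval a (aeval (imageCoords π) f) = eval (coords (π (veroneseVec a))) f := by
  rw [← coe_aeval_eq_eval, ← coe_aeval_eq_eval, RingHom.coe_coe, RingHom.coe_coe,
    ← AlgHom.comp_apply, comp_aeval]
  congr 2
  ext i
  exact eval_veronesePullback a _

lemma mem_vanishingIdeal_projectedVeronese {π : SymMat →ₗ[ℂ] SymMat}
    (hπ : ∃ a, π (veroneseVec a) ≠ 0) (f : MvPolynomial (Fin 6) ℂ) :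
    f ∈ vanishingIdeal (projectedVeronese π) ↔ aeval (imageCoords π) f = 0 := by
  constructor
  · intro hf
    obtain ⟨a₀, ha₀⟩ := hπ
    obtain ⟨i, hi⟩ := Function.ne_iff.mp (coordsEquiv.map_ne_zero_iff.mpr ha₀)
    have heval (a : Fin 3 → ℂ) : eval a (imageCoords π i) = coords (π (veroneseVec a)) i :=
      eval_veronesePullback a _
    have hD : imageCoords π i ≠ 0 := fun h =>
      hi ((heval a₀).symm.trans (by rw [h, map_zero, Pi.zero_apply]))
    refine eq_zero_of_eval_eq_zero_of_eval_ne_zero hD fun a ha => ?_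
    have h : π (veroneseVec a) ≠ 0 := fun h =>
      ha ((heval a).trans (congrFun (coordsEquiv.map_eq_zero_iff.mpr h) i))
    rw [eval_aeval_imageCoords]
    refine hf _ ⟨a, h, rfl⟩ _ ?_
    rw [Projectivization.submodule_mk]
    exact Submodule.mem_span_singleton_self _
  · rintro hf _ ⟨a, ha, rfl⟩ M hM
    rw [Projectivization.submodule_mk, Submodule.mem_span_singleton] at hM
    obtain ⟨c, rfl⟩ := hM
    obtain ⟨b, hb⟩ := exists_veroneseVec_eq_smul c a
    rw [← map_smul, ← hb, ← eval_aeval_imageCoords, hf, map_zero]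

lemma span_range_imageCoords (π : SymMat →ₗ[ℂ] SymMat) :
    Submodule.span ℂ (Set.range (imageCoords π)) =
      (LinearMap.ker π).dualAnnihilator.map veronesePullback := by
  rw [← span_range_coord_comp coordsBasis, Submodule.map_span, ← Set.range_comp]
  rfl

end ProjectedVeronese

section ProjectionFromPoint

lemma coordsBasis_two : coordsBasis 2 = veroneseVec ![0, 0, 1] := by
  refine coordsEquiv.injective (funext fun i => ?_)
  rw [coordsBasis, Module.Basis.coe_ofEquivFun, coordsEquiv.apply_symm_apply]
  fin_cases i <;> simp [coordsEquiv, coords, veroneseVec]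

lemma two_mul_hilbertFunction_imageUnder {π : SymMat →ₗ[ℂ] SymMat}
    (hπ : LinearMap.ker π = Submodule.span ℂ {veroneseVec ![0, 0, 1]}) (n : ℕ) :
    2 * hilbertFunction (imageUnder π veroneseSurface) n = (n + 1) * (3 * n + 2) := by
  have hne : ∃ a, π (veroneseVec a) ≠ 0 := by
    refine ⟨![1, 0, 0], ?_⟩
    rw [Ne, ← LinearMap.mem_ker, hπ, Submodule.mem_span_singleton]
    rintro ⟨c, hc⟩
    simpa [veroneseVec] using congrFun₂ (congrArg Subtype.val hc) 0 0
  rw [imageUnder_veroneseSurface, hilbertFunction_eq_finrank_span_pow fun f => by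
      rw [vanishingIdeal_zariskiClosure, mem_vanishingIdeal_projectedVeronese hne],
    span_range_imageCoords, hπ, ← coordsBasis_two, map_veronesePullback_dualAnnihilator,
    ← restrictSupport_nsmul, nsmul_conicExponents_one, finrank_restrictSupport,
    card_conicExponents]

lemma hasDimAndDegree_of_two_mul_hilbertFunction {Z : Set P5}
    (hZ : ∀ n, 2 * hilbertFunction Z n = (n + 1) * (3 * n + 2)) : HasDimAndDegree Z 2 3 := by
  have ha : (3 / 2 : ℚ) ≠ 0 := by norm_num
  refine ⟨.C (3 / 2) * .X ^ 2 + .C (5 / 2) * .X + .C 1, .of_forall fun n => ?_,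
    Polynomial.degree_quadratic ha, ?_⟩
  · have h : (2 : ℚ) * hilbertFunction Z n = (n + 1) * (3 * n + 2) := by exact_mod_cast hZ n
    simp only [Polynomial.eval_add, Polynomial.eval_mul, Polynomial.eval_C, Polynomial.eval_pow,
      Polynomial.eval_X]
    linarith
  · rw [Polynomial.leadingCoeff_quadratic ha]
    norm_num [Nat.factorial]

lemma congruence_veroneseVec (P : GL (Fin 3) ℂ) (a : Fin 3 → ℂ) :
    congruence P (veroneseVec a) = veroneseVec (a ᵥ* P.1) := by
  apply Subtype.ext
  change (P.1)ᵀ * vecMulVec a a * P.1 = vecMulVec (a ᵥ* P.1) (a ᵥ* P.1)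
  rw [mul_vecMulVec, vecMulVec_mul, mulVec_transpose]

lemma congruence_injective (P : GL (Fin 3) ℂ) : Function.Injective (congruence P) := by
  intro M N h
  have h' : (P.1)ᵀ * M.1 * P.1 = (P.1)ᵀ * N.1 * P.1 := congrArg Subtype.val h
  have hPt : IsUnit (P.1)ᵀ := (Matrix.isUnit_transpose P.1).mpr P.isUnit
  exact Subtype.ext (hPt.mul_left_cancel (P.isUnit.mul_right_cancel h'))

lemma imageUnder_comp_congruence (π : SymMat →ₗ[ℂ] SymMat) (P : GL (Fin 3) ℂ) :
    imageUnder (π ∘ₗ congruence P) veroneseSurface = imageUnder π veroneseSurface := by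
  have hP : Function.Surjective (· ᵥ* P.1) := Matrix.vecMul_surjective_iff_isUnit.mpr P.isUnit
  have h : projectedVeronese (π ∘ₗ congruence P) = projectedVeronese π := by
    ext y
    simp only [projectedVeronese, LinearMap.comp_apply, congruence_veroneseVec]
    exact (hP.exists (p := fun a => ∃ h : π (veroneseVec a) ≠ 0, y = .mk ℂ _ h)).symm
  rw [imageUnder_veroneseSurface, imageUnder_veroneseSurface, h]

theorem IsProjectionVia.hasDimAndDegree {π : SymMat →ₗ[ℂ] SymMat} {p : P5} {Y : Set P5}
    (h : IsProjectionVia π veroneseSurface p Y) (hp : p ∈ veroneseSurface) :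
    HasDimAndDegree Y 2 3 := by
  obtain ⟨hker, rfl⟩ := h
  obtain ⟨x, rfl⟩ := hp
  have he : (![0, 0, 1] : Fin 3 → ℂ) ≠ 0 := by simp
  obtain ⟨P, hP, rfl⟩ := exists_mk_vecMul_eq he x
  rw [submodule_veronese_mk] at hker
  rw [← imageUnder_comp_congruence π P]
  refine hasDimAndDegree_of_two_mul_hilbertFunction (two_mul_hilbertFunction_imageUnder ?_)
  rw [LinearMap.ker_comp, hker, ← congruence_veroneseVec, ← Set.image_singleton,
    ← Submodule.map_span, Submodule.comap_map_eq_of_injective (congruence_injective P)]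

end ProjectionFromPoint

section ReciprocalSurface

/-- The adjugate of a symmetric matrix. -/
def symAdj (A : SymMat) : SymMat :=
  ⟨A.1.adjugate, by
    change (A.1.adjugate)ᵀ = A.1.adjugate
    rw [adjugate_transpose, show A.1ᵀ = A.1 from A.2]⟩

lemma det_smul_symInv {A : SymMat} (hA : A.1.det ≠ 0) : A.1.det • symInv A = symAdj A := by
  apply Subtype.ext
  change A.1.det • A.1⁻¹ = A.1.adjugate
  rw [Matrix.inv_def, smul_smul, Ring.mul_inverse_cancel _ (isUnit_iff_ne_zero.mpr hA), one_smul]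

lemma symInv_ne_zero {A : SymMat} (hA : A.1.det ≠ 0) : symInv A ≠ 0 := by
  intro h
  have hinv : A.1 * A.1⁻¹ = 1 := Matrix.mul_nonsing_inv A.1 (isUnit_iff_ne_zero.mpr hA)
  rw [show A.1⁻¹ = 0 from congrArg Subtype.val h, mul_zero] at hinv
  exact zero_ne_one hinv

lemma symAdj_ne_zero {A : SymMat} (hA : A.1.det ≠ 0) : symAdj A ≠ 0 :=
  det_smul_symInv hA ▸ smul_ne_zero hA (symInv_ne_zero hA)

theorem reciprocalSurface_span_range {A : Fin 3 → SymMat} {π : SymMat →ₗ[ℂ] SymMat}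
    (hπ : ∀ a, π (veroneseVec a) = symAdj (∑ i, a i • A i))
    (hA : ∃ a : Fin 3 → ℂ, (∑ i, a i • A i).1.det ≠ 0) :
    reciprocalSurface (Submodule.span ℂ (Set.range A)) = imageUnder π veroneseSurface := by
  rw [imageUnder_veroneseSurface]
  refine zariskiClosure_congr (le_antisymm (fun f hf => ?_) (vanishingIdeal_anti ?_))
  · obtain ⟨a₀, ha₀⟩ := hA
    rw [mem_vanishingIdeal_projectedVeronese ⟨a₀, hπ a₀ ▸ symAdj_ne_zero ha₀⟩]
    obtain ⟨D, hD⟩ := exists_eval_eq_det fun i => (A i).1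
    replace hD (a : Fin 3 → ℂ) : eval a D = (∑ i, a i • A i).1.det := by simp [hD]
    have hD₀ : D ≠ 0 := by
      rintro rfl
      exact ha₀ (by rw [← hD, map_zero])
    refine eq_zero_of_eval_eq_zero_of_eval_ne_zero hD₀ fun a ha => ?_
    rw [hD] at ha
    rw [eval_aeval_imageCoords, hπ, ← det_smul_symInv ha]
    refine hf _ ⟨_, Submodule.mem_span_range_iff_exists_fun ℂ |>.mpr ⟨a, rfl⟩, ha,
      symInv_ne_zero ha, rfl⟩ _ ?_
    rw [Projectivization.submodule_mk]
    exact Submodule.smul_mem _ _ (Submodule.mem_span_singleton_self _)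
  · rintro _ ⟨B, hB, hdet, h, rfl⟩
    obtain ⟨a, rfl⟩ := (Submodule.mem_span_range_iff_exists_fun ℂ).mp hB
    refine ⟨a, hπ a ▸ symAdj_ne_zero hdet, ?_⟩
    rw [Projectivization.mk_eq_mk_iff']
    exact ⟨_, by rw [hπ, ← det_smul_symInv hdet, inv_smul_smul₀ hdet]⟩

lemma exists_symAdj_congruence (P : GL (Fin 3) ℂ) :
    ∃ Q : GL (Fin 3) ℂ, ∀ M, symAdj (congruence P M) = congruence Q (symAdj M) := by
  have hdet : (P.1.adjugate)ᵀ.det ≠ 0 := by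
    rw [det_transpose, det_adjugate]
    exact pow_ne_zero _ (Matrix.GeneralLinearGroup.det_ne_zero P)
  refine ⟨.mkOfDetNeZero _ hdet, fun M => Subtype.ext ?_⟩
  change ((P.1)ᵀ * M.1 * P.1).adjugate = (P.1.adjugate)ᵀᵀ * M.1.adjugate * (P.1.adjugate)ᵀ
  rw [adjugate_mul_distrib, adjugate_mul_distrib, transpose_transpose, adjugate_transpose,
    Matrix.mul_assoc]

lemma det_congruence_ne_zero {P : GL (Fin 3) ℂ} {M : SymMat} (hM : M.1.det ≠ 0) :
    (congruence P M).1.det ≠ 0 := by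
  change ((P.1)ᵀ * M.1 * P.1).det ≠ 0
  have hP := Matrix.GeneralLinearGroup.det_ne_zero P
  rw [det_mul, det_mul, det_transpose]
  exact mul_ne_zero (mul_ne_zero hP hM) hP

end ReciprocalSurface

section TypesBC

namespace NetType

variable (τ : NetType)

lemma g_sq : τ.g ^ 2 = τ.g := by
  cases τ <;> simp [g]

lemma coe_sum_gen (a : Fin 3 → ℂ) :
    (∑ i, a i • τ.gen i).1 = !![-a 2, 0, a 0 + τ.g * a 2; 0, a 0 - 2 * τ.g * a 2, a 1;
      a 0 + τ.g * a 2, a 1, -9 * τ.g * a 2] := by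
  cases τ <;> ext i j <;> fin_cases i <;> fin_cases j <;>
    simp [Fin.sum_univ_three, gen, genMatrix, g] <;> ring

/-- The linear map through which the adjugates of the matrices of the standard net factor over the
Veronese embedding. Its coordinates are the cofactors of the matrix in `coe_sum_gen`, simplified
with `g ^ 2 = g`. -/
def adjMap : SymMat →ₗ[ℂ] SymMat where
  toFun M := coordsEquiv.symm
    ![18 * τ.g * M.1 2 2 - 9 * τ.g * M.1 0 2 - M.1 1 1,
      8 * τ.g * M.1 2 2 - 2 * τ.g * M.1 0 2 - M.1 0 0,
      2 * τ.g * M.1 2 2 - M.1 0 2,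
      M.1 0 1 + τ.g * M.1 1 2,
      2 * τ.g * M.1 2 2 + τ.g * M.1 0 2 - M.1 0 0,
      M.1 1 2]
  map_add' M N := by
    rw [← map_add]
    refine congrArg _ (funext fun i => ?_)
    fin_cases i <;> simp <;> ring
  map_smul' c M := by
    rw [← map_smul]
    refine congrArg _ (funext fun i => ?_)
    fin_cases i <;> simp <;> ring

lemma adjMap_veroneseVec (a : Fin 3 → ℂ) :
    τ.adjMap (veroneseVec a) = symAdj (∑ i, a i • τ.gen i) := by
  have hadj : (symAdj (∑ i, a i • τ.gen i)).1 = (∑ i, a i • τ.gen i).1.adjugate := rfl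
  rw [← coordsEquiv.injective.eq_iff]
  refine (coordsEquiv.apply_symm_apply _).trans (funext fun i => ?_)
  change _ = coords _ i
  rw [coords, hadj, coe_sum_gen, adjugate_fin_three_of]
  have hg := τ.g_sq
  fin_cases i <;> simp [veroneseVec, vecMulVec_apply] <;> grind

lemma ker_adjMap : LinearMap.ker τ.adjMap = (veronese τ.basePoint).submodule := by
  have hg := τ.g_sq
  rw [basePoint, submodule_veronese_mk]
  ext M
  rw [LinearMap.mem_ker, Submodule.mem_span_singleton]
  refine ⟨fun h => ⟨M.1 2 2, coordsEquiv.injective (funext fun i => ?_)⟩, ?_⟩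
  · have h (i : Fin 6) := congrFun (coordsEquiv.symm.map_eq_zero_iff.mp h) i
    have h₀ := h 0
    have h₁ := h 1
    have h₂ := h 2
    have h₃ := h 3
    have h₅ := h 5
    simp only [Matrix.cons_val, Pi.zero_apply] at h₀ h₁ h₂ h₃ h₅
    change coords _ i = coords _ i
    fin_cases i <;> simp [coords, veroneseVec] <;> grind
  · rintro ⟨c, rfl⟩
    rw [map_smul]
    refine smul_eq_zero_of_right c (coordsEquiv.symm.map_eq_zero_iff.mpr (funext fun i => ?_))
    fin_cases i <;> simp [veroneseVec] <;> grind

end NetType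

lemma exists_isProjectionVia_reciprocalSurface (τ : NetType) (P : GL (Fin 3) ℂ) :
    ∃ π : SymMat →ₗ[ℂ] SymMat,
      (∀ a : Fin 3 → ℂ, π (veroneseVec a) = symAdj (∑ i, a i • congruence P (τ.gen i))) ∧
      IsProjectionVia π veroneseSurface (veronese τ.basePoint)
        (reciprocalSurface (τ.standardNet.map (congruence P))) := by
  obtain ⟨Q, hQ⟩ := exists_symAdj_congruence P
  have hsum (a : Fin 3 → ℂ) :
      ∑ i, a i • congruence P (τ.gen i) = congruence P (∑ i, a i • τ.gen i) := by
    simp only [map_sum, map_smul]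
  have hπ (a : Fin 3 → ℂ) : (congruence Q ∘ₗ τ.adjMap) (veroneseVec a) =
      symAdj (∑ i, a i • congruence P (τ.gen i)) := by
    rw [LinearMap.comp_apply, τ.adjMap_veroneseVec, hsum, hQ]
  have hdet : ∃ a : Fin 3 → ℂ, (∑ i, a i • congruence P (τ.gen i)).1.det ≠ 0 := by
    refine ⟨![1, 0, 0], hsum _ ▸ det_congruence_ne_zero ?_⟩
    rw [τ.coe_sum_gen]
    simp [det_fin_three]
  refine ⟨congruence Q ∘ₗ τ.adjMap, hπ, ?_, ?_⟩
  · rw [LinearMap.ker_comp_of_ker_eq_bot _ (LinearMap.ker_eq_bot.mpr (congruence_injective Q)),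
      τ.ker_adjMap]
  · rw [NetType.standardNet, Submodule.map_span, ← Set.range_comp]
    exact reciprocalSurface_span_range hπ hdet

end TypesBC

end

end NetsOfConics

open NetsOfConics in
theorem proposition3p5 (τ : NetType) (L : Submodule ℂ SymMat) (hL : IsOfType τ L) :
    -- the reciprocal surface is a surface of degree 3
    HasDimAndDegree (reciprocalSurface L) 2 3 ∧
    -- it is a projection of the Veronese surface from a point on the Veronese surface
    (∃ p ∈ veroneseSurface, ∃ π : SymMat →ₗ[ℂ] SymMat,
      IsProjectionVia π veroneseSurface p (reciprocalSurface L)) ∧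
    -- more precisely: write `L` as the transform of the standard net by a congruence; then the
    -- linear map through which the adjugate of a general element of the net factors over the
    -- Veronese embedding is such a projection, with center `v(2g : 0 : 1)`
    (∀ P : GL (Fin 3) ℂ, L = τ.standardNet.map (congruence P) →
      ∃ π : SymMat →ₗ[ℂ] SymMat,
        (∀ a : Fin 3 → ℂ, (π (veroneseVec a)).1 =
          (∑ i, a i • congruence P (τ.gen i)).1.adjugate) ∧
        IsProjectionVia π veroneseSurface (veronese τ.basePoint) (reciprocalSurface L)) := by
  have hproj (P : GL (Fin 3) ℂ) (hP : L = τ.standardNet.map (congruence P)) :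
      ∃ π : SymMat →ₗ[ℂ] SymMat,
        (∀ a : Fin 3 → ℂ, (π (veroneseVec a)).1 =
          (∑ i, a i • congruence P (τ.gen i)).1.adjugate) ∧
        IsProjectionVia π veroneseSurface (veronese τ.basePoint) (reciprocalSurface L) := by
    obtain ⟨π, hπ, hvia⟩ := exists_isProjectionVia_reciprocalSurface τ P
    exact ⟨π, fun a => congrArg Subtype.val (hπ a), hP ▸ hvia⟩
  obtain ⟨P, hP⟩ := hL
  obtain ⟨π, -, hvia⟩ := hproj P hP
  exact ⟨hvia.hasDimAndDegree ⟨_, rfl⟩, ⟨_, ⟨_, rfl⟩, π, hvia⟩, hproj⟩
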